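/- For an open set $\Omega\subseteq\mathbb R^n$ let $\mathcal D(\Omega)$ be the space of complex-valued test functions with its usual (LF) topology, and let $C^\infty(\Omega,E)$, for a locally convex space $E$, carry the topology of uniform convergence on compact sets in all derivatives; write $C^\infty(\Omega)=C^\infty(\Omega,\mathbb C)$. Let $SK(\Omega)=C^\infty(\Omega,\mathcal D(\Omega))$ be the space of smoothing kernels and $\mathcal E(\Omega)=C^\infty(SK(\Omega),C^\infty(\Omega))$ the space of maps $R\colon SK(\Omega)\to C^\infty(\Omega)$ that are smooth in the sense of convenient calculus (they map smooth curves to smooth curves). An element $R\in\mathcal E(\Omega)$ is called *local* if for all open $W\subseteq\Omega$ and $\vec\varphi,\vec\psi\in SK(\Omega)$, $\vec\varphi|_W=\vec\psi|_W$ implies $R(\vec\varphi)|_W=R(\vec\psi)|_W$; *point-local* if $\vec\varphi(x)=\vec\psi(x)$ implies $R(\vec\varphi)(x)=R(\vec\psi)(x)$ for all $x\in\Omega$ and $\vec\varphi,\vec\psi\in SK(\Omega)$; *point-independent* if $\vec\varphi(x)=\vec\psi(y)$ implies $R(\vec\varphi)(x)=R(\vec\psi)(y)$ for all $x,y\in\Omega$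 and $\vec\varphi,\vec\psi\in SK(\Omega)$. Let $\mathcal E_{loc}(\Omega)$ be the set of local elements of $\mathcal E(\Omega)$. **Theorem.** Let $\Omega\subseteq\mathbb R^n$ be open, let $V\subseteq U\subseteq\Omega$ be open and let $R\in\mathcal E_{loc}(U)$. Then there is a unique element $R|_V\in\mathcal E_{loc}(V)$ such that (*) for any open set $W\subseteq\Omega$ whose closure in $\Omega$ is contained in $V$, and all $\vec\varphi\in SK(V)$, $\vec\psi\in SK(U)$ with $\vec\varphi|_W=\vec\psi|_W$ (where $\mathcal D(V)\subseteq\mathcal D(U)$ by extension by zero), we have $R|_V(\vec\varphi)|_W=R(\vec\psi)|_W$. The mapping $R\mapsto R|_V$ preserves linearity and the locality properties: if $R$ is linear (respectively linear and continuous, point-local, point-independent), then so is $R|_V$. Furthermore, for open sets $W\subseteq V\subseteq U\subseteq\Omega$ and $R\in\mathcal E_{loc}(U)$ we have $(R|_V)|_W=R|_W$. -/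

import Mathlib

open Filter Topology TopologicalSpace

noncomputable section

namespace SmoothingKernels

/-! ### Smooth functions on an open subset of `ℝⁿ` with values in a topological vector space -/

section SmoothFunctions

variable {n : ℕ} {Ω : Opens (EuclideanSpace ℝ (Fin n))}

theorem extend_comp₂ {F : Type*} [Zero F] (op : F → F → F) (hop : op 0 0 = 0) (f g : Ω → F)
    (y : EuclideanSpace ℝ (Fin n)) :
    Function.extend Subtype.val (fun x => op (f x) (g x)) 0 y =
      op (Function.extend Subtype.val f 0 y) (Function.extend Subtype.val g 0 y) := by
  by_cases hy : y ∈ Ω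
  · have h (k : Ω → F) : Function.extend Subtype.val k 0 y = k ⟨y, hy⟩ :=
      Subtype.val_injective.extend_apply k 0 ⟨y, hy⟩
    rw [h, h, h]
  · have hy' : ¬ ∃ a : Ω, (a : EuclideanSpace ℝ (Fin n)) = y := by
      rintro ⟨a, rfl⟩
      exact hy a.2
    simp [Function.extend_apply' _ _ _ hy', hop]

variable {E : Type*} [AddCommGroup E] [Module ℝ E] [TopologicalSpace E]

/-- `g` is the partial derivative `∂ᵢ f` on `Ω`: for all `x ∈ Ω`, the difference quotients
`(f (x + t eᵢ) - f x) / t` converge to `g x` as `t → 0`, `t ≠ 0`. (The function `f` is extended by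
zero outside `Ω`, which does not matter since `x + t eᵢ ∈ Ω` for small `t`.) -/
def IsPartialDeriv (i : Fin n) (f g : Ω → E) : Prop :=
  ∀ x : Ω, Tendsto
    (fun t : ℝ => t⁻¹ • (Function.extend Subtype.val f 0
      ((x : EuclideanSpace ℝ (Fin n)) + t • EuclideanSpace.single i (1 : ℝ)) - f x))
    (𝓝[≠] 0) (𝓝 (g x))

/-- `D` is the family of all iterated partial derivatives of `f`, all of them continuous;
`D [i₁, …, iₖ] = ∂_{i₁} ⋯ ∂_{iₖ} f`. -/
structure IsJet (f : Ω → E) (D : List (Fin n) → Ω → E) : Prop where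
  nil : D [] = f
  continuous : ∀ l, Continuous (D l)
  cons : ∀ l i, IsPartialDeriv i (D l) (D (i :: l))

variable (Ω E) in
/-- The space `C^∞(Ω, E)`: functions `Ω → E` that have continuous partial derivatives of all
orders. -/
structure SmoothFun where
  /-- the underlying function -/
  toFun : Ω → E
  smooth' : ∃ D, IsJet toFun D

namespace SmoothFun

instance : FunLike (SmoothFun Ω E) Ω E where
  coe := toFun
  coe_injective := by
    rintro ⟨f, hf⟩ ⟨g, hg⟩ h
    congr

@[ext]
theorem ext {f g : SmoothFun Ω E} (h : ∀ x, f x = g x) : f = g := DFunLike.ext f g h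

/-- The iterated partial derivative `∂_{i₁} ⋯ ∂_{iₖ} f`, as a continuous function on `Ω`. -/
def deriv (f : SmoothFun Ω E) (l : List (Fin n)) : C(Ω, E) :=
  ⟨f.smooth'.choose l, f.smooth'.choose_spec.continuous l⟩

theorem isJet_deriv (f : SmoothFun Ω E) : IsJet (⇑f) (fun l => ⇑(f.deriv l)) :=
  f.smooth'.choose_spec

/-- Iterated partial derivatives are unique. -/
theorem deriv_eq [T2Space E] (f : SmoothFun Ω E) {D : List (Fin n) → Ω → E} (hD : IsJet (⇑f) D)
    (l : List (Fin n)) : ⇑(f.deriv l) = D l := by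
  induction l with
  | nil => exact f.isJet_deriv.nil.trans hD.nil.symm
  | cons i l ih =>
    funext x
    have h1 := f.isJet_deriv.cons l i x
    have h2 := hD.cons l i x
    rw [← ih] at h2
    exact tendsto_nhds_unique h1 h2

/-- The natural topology of `C^∞(Ω, E)`: uniform convergence on compact sets in all
derivatives. -/
instance : TopologicalSpace (SmoothFun Ω E) :=
  ⨅ l : List (Fin n),
    TopologicalSpace.induced (fun f : SmoothFun Ω E => f.deriv l) inferInstance

end SmoothFun

section Algebra

theorem IsJet.zero : IsJet (0 : Ω → E) (fun _ => 0) where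
  nil := rfl
  continuous _ := continuous_zero
  cons _ i x := by
    have h := extend_comp₂ (fun _ _ => (0 : E)) rfl (0 : Ω → E) 0
    have h0 : (fun _ : Ω => (0 : E)) = 0 := rfl
    simp only [h0] at h
    simpa [h] using tendsto_const_nhds

variable {𝕜 : Type*} [Semiring 𝕜] [Module 𝕜 E] [SMulCommClass ℝ 𝕜 E] [ContinuousConstSMul 𝕜 E]

theorem IsJet.smul (a : 𝕜) {f : Ω → E} {D : List (Fin n) → Ω → E} (hf : IsJet f D) :
    IsJet (a • f) (fun l => a • D l) where
  nil := by rw [hf.nil]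
  continuous l := (hf.continuous l).const_smul a
  cons l i x := by
    have h := (hf.cons l i x).const_smul a
    refine h.congr fun t => ?_
    rw [← smul_comm]
    congr 1
    have := extend_comp₂ (fun b _ => a • b) (by simp) (D l) (D l)
    have h0 : (fun x => a • D l x) = a • D l := rfl
    rw [h0] at this
    rw [this, Pi.smul_apply, smul_sub]

variable [IsTopologicalAddGroup E]

theorem IsJet.add {f g : Ω → E} {D D' : List (Fin n) → Ω → E} (hf : IsJet f D) (hg : IsJet g D') :
    IsJet (f + g) (fun l => D l + D' l) where
  nil := by rw [hf.nil, hg.nil]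
  continuous l := (hf.continuous l).add (hg.continuous l)
  cons l i x := by
    have h := (hf.cons l i x).add (hg.cons l i x)
    refine h.congr fun t => ?_
    rw [← smul_add]
    congr 1
    have := extend_comp₂ (fun a b => a + b) (by simp) (D l) (D' l)
    have h0 : (fun x => D l x + D' l x) = D l + D' l := rfl
    rw [h0] at this
    rw [this, Pi.add_apply]
    abel

theorem IsJet.neg {f : Ω → E} {D : List (Fin n) → Ω → E} (hf : IsJet f D) :
    IsJet (-f) (fun l => -D l) where
  nil := by rw [hf.nil]
  continuous l := (hf.continuous l).neg
  cons l i x := by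
    have h := (hf.cons l i x).neg
    refine h.congr fun t => ?_
    rw [← smul_neg]
    congr 1
    have := extend_comp₂ (fun b _ => -b) (by simp) (D l) (D l)
    have h0 : (fun x => -D l x) = -D l := rfl
    rw [h0] at this
    rw [this, Pi.neg_apply]
    abel

namespace SmoothFun

instance : Zero (SmoothFun Ω E) := ⟨⟨0, _, IsJet.zero⟩⟩

instance : Add (SmoothFun Ω E) :=
  ⟨fun f g => ⟨⇑f + ⇑g, _, f.isJet_deriv.add g.isJet_deriv⟩⟩

instance : Neg (SmoothFun Ω E) := ⟨fun f => ⟨-⇑f, _, f.isJet_deriv.neg⟩⟩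

instance : Sub (SmoothFun Ω E) :=
  ⟨fun f g => ⟨⇑f - ⇑g, by
    rw [sub_eq_add_neg]
    exact ⟨_, f.isJet_deriv.add g.isJet_deriv.neg⟩⟩⟩

instance instSMul : SMul 𝕜 (SmoothFun Ω E) := ⟨fun a f => ⟨a • ⇑f, _, f.isJet_deriv.smul a⟩⟩

instance : AddCommGroup (SmoothFun Ω E) :=
  Function.Injective.addCommGroup (fun f : SmoothFun Ω E => (⇑f : Ω → E)) DFunLike.coe_injective
    rfl (fun _ _ => rfl) (fun _ => rfl) (fun _ _ => rfl) (fun _ _ => rfl) (fun _ _ => rfl)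

instance : Module 𝕜 (SmoothFun Ω E) :=
  Function.Injective.module 𝕜
    ({ toFun := fun f => (⇑f : Ω → E), map_zero' := rfl, map_add' := fun _ _ => rfl } :
      SmoothFun Ω E →+ (Ω → E))
    DFunLike.coe_injective (fun _ _ => rfl)

end SmoothFun

end Algebra

end SmoothFunctions
/-! ### Smooth maps between locally convex spaces (convenient calculus) -/

/-- A curve `c : ℝ → E` in a topological vector space is smooth if all its iterated derivatives
exist (as limits of difference quotients). -/
def IsSmoothCurve {E : Type*} [AddCommGroup E] [Module ℝ E] [TopologicalSpace E] (c : ℝ → E) :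
    Prop :=
  ∃ D : ℕ → ℝ → E, D 0 = c ∧
    ∀ k t, Tendsto (fun h : ℝ => h⁻¹ • (D k (t + h) - D k t)) (𝓝[≠] 0) (𝓝 (D (k + 1) t))

/-- A map is smooth, in the sense of convenient calculus, if it maps smooth curves to smooth
curves. -/
def IsSmoothMap {E F : Type*} [AddCommGroup E] [Module ℝ E] [TopologicalSpace E]
    [AddCommGroup F] [Module ℝ F] [TopologicalSpace F] (R : E → F) : Prop :=
  ∀ c : ℝ → E, IsSmoothCurve c → IsSmoothCurve (R ∘ c)

/-! ### Smoothing kernels and the basic space -/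

variable {n : ℕ}

instance (Ω : Opens (EuclideanSpace ℝ (Fin n))) :
    ContinuousConstSMul ℂ (TestFunction Ω ℂ ⊤) where
  continuous_const_smul a :=
    (TestFunction.postcompCLM (Ω := Ω) (n := ⊤) (a • ContinuousLinearMap.id ℂ ℂ)).continuous

/-- The space `C^∞(Ω)` of complex-valued smooth functions on `Ω`. -/
abbrev CInf (Ω : Opens (EuclideanSpace ℝ (Fin n))) : Type := SmoothFun Ω ℂ

/-- The space `SK(Ω) = C^∞(Ω, 𝓓(Ω))` of smoothing kernels, where `𝓓(Ω)` is the space of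
complex-valued test functions on `Ω` with its usual (LF) topology. -/
abbrev SK (Ω : Opens (EuclideanSpace ℝ (Fin n))) : Type := SmoothFun Ω (TestFunction Ω ℂ ⊤)

/-- The basic space `𝓔(Ω) = C^∞(SK(Ω), C^∞(Ω))`. -/
structure BasicSpace (Ω : Opens (EuclideanSpace ℝ (Fin n))) where
  /-- the underlying map -/
  toFun : SK Ω → CInf Ω
  smooth' : IsSmoothMap toFun

namespace BasicSpace

variable {Ω : Opens (EuclideanSpace ℝ (Fin n))}

instance : FunLike (BasicSpace Ω) (SK Ω) (CInf Ω) where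
  coe := toFun
  coe_injective := by
    rintro ⟨f, hf⟩ ⟨g, hg⟩ h
    congr

/-- `R` is local: if `φ|_W = ψ|_W` then `R(φ)|_W = R(ψ)|_W`, for all open `W ⊆ Ω`. -/
def IsLocal (R : BasicSpace Ω) : Prop :=
  ∀ W : Opens (EuclideanSpace ℝ (Fin n)), W ≤ Ω → ∀ φ ψ : SK Ω,
    (∀ x : Ω, (x : EuclideanSpace ℝ (Fin n)) ∈ W → φ x = ψ x) →
      ∀ x : Ω, (x : EuclideanSpace ℝ (Fin n)) ∈ W → R φ x = R ψ x

/-- `R` is point-local: if `φ(x) = ψ(x)` then `R(φ)(x) = R(ψ)(x)`. -/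
def IsPointLocal (R : BasicSpace Ω) : Prop :=
  ∀ (x : Ω) (φ ψ : SK Ω), φ x = ψ x → R φ x = R ψ x

/-- `R` is point-independent: if `φ(x) = ψ(y)` then `R(φ)(x) = R(ψ)(y)`. -/
def IsPointIndependent (R : BasicSpace Ω) : Prop :=
  ∀ (x y : Ω) (φ ψ : SK Ω), φ x = ψ y → R φ x = R ψ y

/-- `R` is a (complex) linear map. -/
def IsLinear (R : BasicSpace Ω) : Prop := IsLinearMap ℂ (R : SK Ω → CInf Ω)

/-- `R` belongs to `𝓛(SK(Ω), C^∞(Ω))`, the space of continuous linear maps. -/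
def IsContinuousLinear (R : BasicSpace Ω) : Prop :=
  R.IsLinear ∧ Continuous (R : SK Ω → CInf Ω)

end BasicSpace

/-- The space `𝓔_loc(Ω)` of local elements of `𝓔(Ω)`. -/
def ELoc (Ω : Opens (EuclideanSpace ℝ (Fin n))) : Set (BasicSpace Ω) := {R | R.IsLocal}

/-- For `V ⊆ U ⊆ Ω`, `R ∈ 𝓔(U)` and `S ∈ 𝓔(V)`: for every open set `W` whose closure in `Ω` is
contained in `V`, and all `φ ∈ SK(V)`, `ψ ∈ SK(U)` with `φ|_W = ψ|_W` we have
`S(φ)|_W = R(ψ)|_W`. Here elements of `𝓓(V)` and `𝓓(U)` are compared as functions on `ℝⁿ`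
(extended by zero). -/
def IsRestriction (Ω : Opens (EuclideanSpace ℝ (Fin n))) {U V : Opens (EuclideanSpace ℝ (Fin n))}
    (hVU : V ≤ U) (R : BasicSpace U) (S : BasicSpace V) : Prop :=
  ∀ W : Opens (EuclideanSpace ℝ (Fin n)), W ≤ Ω →
    closure (W : Set (EuclideanSpace ℝ (Fin n))) ∩ Ω ⊆ V →
    ∀ (φ : SK V) (ψ : SK U),
      (∀ x : V, (x : EuclideanSpace ℝ (Fin n)) ∈ W →
        (⇑(φ x) : EuclideanSpace ℝ (Fin n) → ℂ) = ⇑(ψ ⟨x, hVU x.2⟩)) →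
      ∀ x : V, (x : EuclideanSpace ℝ (Fin n)) ∈ W → S φ x = R ψ ⟨x, hVU x.2⟩

end SmoothingKernels

end

open SmoothingKernels

/-! For `x` in `V` take a real test function `bump x` on `V` equal to `1` near `x`, multiply a
kernel `φ` on `V` by it, extend by zero to `U`, and let the value of `R|_V(φ)` at `x` be that of `R`
on this cut-off kernel. By locality of `R`, any kernel on `U` agreeing with `φ` near `x` gives the
same value (`restrictFun_eq`). Hence near each point a single cutoff describes `R|_V(φ)`, and every
claim reduces to one about `R` composed with a fixed cutoff. Two analytic facts carry this: cutting
off is linear and continuous (`SmoothFun.continuous_mulExtend`, from the Leibniz rule), and both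
smoothness of functions and convergence in `C^∞` are local (`SmoothFun.exists_isJet_of_locally`,
`SmoothFun.tendsto_of_locally`). -/

namespace SmoothingKernels

/-! ### Pointwise calculus of partial derivatives -/

section PartialDerivatives

variable {n : ℕ} {U V : Opens (EuclideanSpace ℝ (Fin n))}

theorem extend_of_mem {E : Type*} [Zero E] (f : V → E) {y : EuclideanSpace ℝ (Fin n)}
    (hy : y ∈ V) : Function.extend Subtype.val f 0 y = f ⟨y, hy⟩ :=
  Subtype.val_injective.extend_apply f 0 ⟨y, hy⟩

theorem extend_restrict_eventuallyEq {E : Type*} [Zero E] (F : EuclideanSpace ℝ (Fin n) → E)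
    {x : EuclideanSpace ℝ (Fin n)} (hx : x ∈ U) :
    Function.extend Subtype.val (fun y : U => F y) 0 =ᶠ[𝓝 x] F :=
  eventually_of_mem (U.isOpen.mem_nhds hx) fun _ hy => extend_of_mem _ hy

variable {E E' : Type*} [AddCommGroup E] [Module ℝ E] [TopologicalSpace E]
  [AddCommGroup E'] [Module ℝ E'] [TopologicalSpace E']

/-- `F` has the partial derivative `e` in the direction `i` at the point `x`. -/
def HasPartialDerivAt (i : Fin n) (F : EuclideanSpace ℝ (Fin n) → E) (e : E)
    (x : EuclideanSpace ℝ (Fin n)) : Prop :=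
  Tendsto (fun t : ℝ => t⁻¹ • (F (x + t • EuclideanSpace.single i (1 : ℝ)) - F x))
    (𝓝[≠] 0) (𝓝 e)

/-- Passing to germs of functions on the whole space allows functions with different domains to be
compared near a point. -/
theorem isPartialDeriv_iff {i : Fin n} {f g : V → E} :
    IsPartialDeriv i f g ↔
      ∀ x : V, HasPartialDerivAt i (Function.extend Subtype.val f 0) (g x) x := by
  refine forall_congr' fun x => ?_
  rw [HasPartialDerivAt, extend_of_mem f x.2]

theorem tendsto_add_smul_single (i : Fin n) (x : EuclideanSpace ℝ (Fin n)) :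
    Tendsto (fun t : ℝ => x + t • EuclideanSpace.single i (1 : ℝ)) (𝓝[≠] 0) (𝓝 x) := by
  have h : Continuous fun t : ℝ => x + t • EuclideanSpace.single i (1 : ℝ) := by fun_prop
  have h' := (h.tendsto 0).mono_left (nhdsWithin_le_nhds (s := {0}ᶜ))
  simpa using h'

theorem HasPartialDerivAt.congr {i : Fin n} {F G : EuclideanSpace ℝ (Fin n) → E} {e : E}
    {x : EuclideanSpace ℝ (Fin n)} (hF : HasPartialDerivAt i F e x) (h : F =ᶠ[𝓝 x] G) :
    HasPartialDerivAt i G e x := by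
  refine Tendsto.congr' ?_ hF
  filter_upwards [(tendsto_add_smul_single i x).eventually h] with t ht
  rw [ht, h.self_of_nhds]

theorem HasPartialDerivAt.unique [T2Space E] {i : Fin n} {F : EuclideanSpace ℝ (Fin n) → E}
    {e e' : E} {x : EuclideanSpace ℝ (Fin n)} (h : HasPartialDerivAt i F e x)
    (h' : HasPartialDerivAt i F e' x) : e = e' :=
  tendsto_nhds_unique h h'

theorem hasPartialDerivAt_zero (i : Fin n) (x : EuclideanSpace ℝ (Fin n)) :
    HasPartialDerivAt i (0 : EuclideanSpace ℝ (Fin n) → E) 0 x := by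
  simpa [HasPartialDerivAt] using tendsto_const_nhds

theorem HasPartialDerivAt.add [ContinuousAdd E] {i : Fin n}
    {F G : EuclideanSpace ℝ (Fin n) → E} {e e' : E} {x : EuclideanSpace ℝ (Fin n)}
    (hF : HasPartialDerivAt i F e x) (hG : HasPartialDerivAt i G e' x) :
    HasPartialDerivAt i (F + G) (e + e') x := by
  refine (Tendsto.add hF hG).congr fun t => ?_
  rw [← smul_add, Pi.add_apply, Pi.add_apply]
  congr 1
  abel

theorem HasPartialDerivAt.clm (L : E →L[ℝ] E') {i : Fin n}
    {F : EuclideanSpace ℝ (Fin n) → E} {e : E} {x : EuclideanSpace ℝ (Fin n)}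
    (hF : HasPartialDerivAt i F e x) : HasPartialDerivAt i (fun y => L (F y)) (L e) x := by
  refine ((L.continuous.tendsto e).comp hF).congr fun t => ?_
  simp

theorem HasPartialDerivAt.smul [IsTopologicalAddGroup E] [ContinuousSMul ℝ E] {i : Fin n}
    {a : EuclideanSpace ℝ (Fin n) → ℝ} {F : EuclideanSpace ℝ (Fin n) → E} {a' : ℝ} {e : E}
    {x : EuclideanSpace ℝ (Fin n)} (hac : ContinuousAt a x) (ha : HasPartialDerivAt i a a' x)
    (hF : HasPartialDerivAt i F e x) :
    HasPartialDerivAt i (fun y => a y • F y) (a' • F x + a x • e) x := by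
  -- The increment of `a • F` splits as the increment of `a` times `F x` plus the shifted value of
  -- `a` times the increment of `F`.
  have h := (Tendsto.smul_const ha (F x)).add
    (Tendsto.smul (hac.tendsto.comp (tendsto_add_smul_single i x)) hF)
  refine h.congr fun t => ?_
  simp only [Function.comp_apply, smul_eq_mul, mul_smul, sub_smul, smul_sub]
  rw [smul_comm (a (x + t • _)), smul_comm (a (x + t • _))]
  abel

end PartialDerivatives

/-! ### Multiplication by a test function and extension by zero -/

section ZeroExtension

variable {n : ℕ} {U V : Opens (EuclideanSpace ℝ (Fin n))}

/-- The iterated partial derivatives of a real-valued test function. -/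
noncomputable def testDeriv (ξ : TestFunction V ℝ ⊤) : List (Fin n) → TestFunction V ℝ ⊤
  | [] => ξ
  | i :: l => TestFunction.lineDerivCLM ℝ (EuclideanSpace.single i (1 : ℝ)) (testDeriv ξ l)

theorem hasPartialDerivAt_testDeriv (ξ : TestFunction V ℝ ⊤) (l : List (Fin n)) (i : Fin n)
    (x : EuclideanSpace ℝ (Fin n)) :
    HasPartialDerivAt i (testDeriv ξ l) (testDeriv ξ (i :: l) x) x := by
  have hd : DifferentiableAt ℝ (testDeriv ξ l) x :=
    (testDeriv ξ l).contDiff.differentiable (by simp) x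
  have h := (hd.lineDifferentiableAt (v := EuclideanSpace.single i (1 : ℝ))).hasLineDerivAt
  rw [testDeriv, TestFunction.lineDerivCLM_apply_of_le (by simp)]
  simpa [HasPartialDerivAt] using hasDerivAt_iff_tendsto_slope_zero.1 h

/-- All ways of splitting a list into two complementary sublists. -/
def splits {α : Type*} : List α → List (List α × List α)
  | [] => [([], [])]
  | i :: l => (splits l).flatMap fun p => [(i :: p.1, p.2), (p.1, i :: p.2)]

variable {E E' : Type*} [AddCommGroup E] [Module ℝ E] [TopologicalSpace E]
  [AddCommGroup E'] [Module ℝ E'] [TopologicalSpace E']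

/-- The product of a test function on `V` with `L ∘ g`, extended by zero outside `V`. -/
noncomputable def mulExtend (ξ : TestFunction V ℝ ⊤) (L : E →L[ℝ] E') (g : V → E)
    (x : EuclideanSpace ℝ (Fin n)) : E' :=
  ξ x • L (Function.extend Subtype.val g 0 x)

theorem mulExtend_of_mem (ξ : TestFunction V ℝ ⊤) (L : E →L[ℝ] E') (g : V → E)
    {x : EuclideanSpace ℝ (Fin n)} (hx : x ∈ V) :
    mulExtend ξ L g x = ξ x • L (g ⟨x, hx⟩) := by
  rw [mulExtend, extend_of_mem]

theorem testFunction_eventuallyEq_zero (ξ : TestFunction V ℝ ⊤) {x : EuclideanSpace ℝ (Fin n)}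
    (hx : x ∉ V) : ξ =ᶠ[𝓝 x] 0 :=
  notMem_tsupport_iff_eventuallyEq.1 fun h => hx (ξ.tsupport_subset h)

variable [ContinuousSMul ℝ E']

/-- Outside `V` the factor `ξ` vanishes on a neighbourhood that does not depend on the parameter.
The parameter space `X` will be the function space itself, which turns joint continuity into
continuity of the multiplication operator. -/
theorem continuous_mulExtend {X : Type*} [TopologicalSpace X] (ξ : TestFunction V ℝ ⊤)
    (L : E →L[ℝ] E') {g : X → V → E} (hg : Continuous fun p : X × V => g p.1 p.2) :
    Continuous fun p : X × EuclideanSpace ℝ (Fin n) => mulExtend ξ L (g p.1) p.2 := by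
  rw [continuous_iff_continuousAt]
  rintro ⟨a, x⟩
  by_cases hx : x ∈ V
  · have hi : IsOpenEmbedding (fun p : X × V => (p.1, (p.2 : EuclideanSpace ℝ (Fin n)))) :=
      IsOpenEmbedding.id.prodMap V.isOpen.isOpenEmbedding_subtypeVal
    have h : Continuous fun p : X × V => ξ p.2 • L (g p.1 p.2) :=
      (ξ.continuous.comp (continuous_subtype_val.comp continuous_snd)).smul (L.continuous.comp hg)
    refine (hi.continuousAt_iff (x := (a, ⟨x, hx⟩))).1 ?_
    convert h.continuousAt using 1
    funext p
    exact mulExtend_of_mem ξ L _ p.2.2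
  · have h : (fun p : X × EuclideanSpace ℝ (Fin n) => mulExtend ξ L (g p.1) p.2)
        =ᶠ[𝓝 (a, x)] fun _ => 0 := by
      filter_upwards [continuous_snd.continuousAt.eventually
        (testFunction_eventuallyEq_zero ξ hx)] with p hp
      simp [mulExtend, hp]
    exact continuousAt_const.congr h.symm

variable [IsTopologicalAddGroup E']

theorem HasPartialDerivAt.mulExtend (ξ : TestFunction V ℝ ⊤) (L : E →L[ℝ] E') {i : Fin n}
    {f g : V → E} (hfg : IsPartialDeriv i f g) (l : List (Fin n))
    (x : EuclideanSpace ℝ (Fin n)) :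
    HasPartialDerivAt i (mulExtend (testDeriv ξ l) L f)
      (mulExtend (testDeriv ξ (i :: l)) L f x + mulExtend (testDeriv ξ l) L g x) x := by
  by_cases hx : x ∈ V
  · rw [SmoothingKernels.mulExtend, mulExtend_of_mem _ _ g hx]
    exact (hasPartialDerivAt_testDeriv ξ l i x).smul (testDeriv ξ l).continuous.continuousAt
      ((isPartialDeriv_iff.1 hfg ⟨x, hx⟩).clm L)
  · have h0 := fun l' => testFunction_eventuallyEq_zero (testDeriv ξ l') hx
    have h1 : SmoothingKernels.mulExtend (testDeriv ξ l) L f =ᶠ[𝓝 x] 0 := by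
      filter_upwards [h0 l] with y hy
      simp [SmoothingKernels.mulExtend, hy]
    have h2 : SmoothingKernels.mulExtend (testDeriv ξ (i :: l)) L f x +
        SmoothingKernels.mulExtend (testDeriv ξ l) L g x = 0 := by
      simp [SmoothingKernels.mulExtend, (h0 _).self_of_nhds]
    rw [h2]
    exact (hasPartialDerivAt_zero i x).congr h1.symm

/-- The iterated partial derivatives of `mulExtend`, by the Leibniz rule. -/
noncomputable def leibniz (ξ : TestFunction V ℝ ⊤) (L : E →L[ℝ] E') (D : List (Fin n) → V → E)
    (s : List (List (Fin n) × List (Fin n))) : EuclideanSpace ℝ (Fin n) → E' :=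
  fun x => (s.map fun p => mulExtend (testDeriv ξ p.1) L (D p.2) x).sum

theorem continuous_leibniz {X : Type*} [TopologicalSpace X] (ξ : TestFunction V ℝ ⊤)
    (L : E →L[ℝ] E') {D : X → List (Fin n) → V → E}
    (hD : ∀ l, Continuous fun p : X × V => D p.1 l p.2)
    (s : List (List (Fin n) × List (Fin n))) :
    Continuous fun p : X × EuclideanSpace ℝ (Fin n) => leibniz ξ L (D p.1) s p.2 := by
  induction s with
  | nil => simpa [leibniz] using continuous_const
  | cons q s ih =>
    simp only [leibniz, List.map_cons, List.sum_cons] at ih ⊢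
    exact (continuous_mulExtend _ L (g := fun a => D a q.2) (hD q.2)).add ih

/-- The product rule sends each term to two terms, exactly as in the recursion of `splits`. -/
theorem HasPartialDerivAt.leibniz (ξ : TestFunction V ℝ ⊤) (L : E →L[ℝ] E') {f : V → E}
    {D : List (Fin n) → V → E} (hD : IsJet f D) (i : Fin n)
    (s : List (List (Fin n) × List (Fin n))) (x : EuclideanSpace ℝ (Fin n)) :
    HasPartialDerivAt i (leibniz ξ L D s)
      (leibniz ξ L D (s.flatMap fun p => [(i :: p.1, p.2), (p.1, i :: p.2)]) x) x := by
  induction s with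
  | nil => exact hasPartialDerivAt_zero i x
  | cons q s ih =>
    have h := (HasPartialDerivAt.mulExtend ξ L (hD.cons q.2 i) q.1 x).add ih
    simp only [SmoothingKernels.leibniz, List.flatMap_cons, List.map_append, List.map_cons,
      List.map_nil, List.sum_append, List.sum_cons, List.sum_nil, add_zero] at h ⊢
    exact h

theorem IsJet.leibniz (ξ : TestFunction V ℝ ⊤) (L : E →L[ℝ] E') {f : V → E}
    {D : List (Fin n) → V → E} (hD : IsJet f D) :
    IsJet (fun x : U => mulExtend ξ L f x) (fun l (x : U) => leibniz ξ L D (splits l) x) where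
  nil := by
    funext x
    simp [SmoothingKernels.leibniz, splits, testDeriv, hD.nil]
  continuous l := by
    have h := continuous_leibniz (X := Unit) (D := fun _ => D) ξ L
      (fun l => (hD.continuous l).comp continuous_snd) (splits l)
    exact h.comp (continuous_const.prodMk continuous_subtype_val : Continuous fun x : U =>
      ((), (x : EuclideanSpace ℝ (Fin n))))
  cons l i := isPartialDeriv_iff.2 fun x =>
    (HasPartialDerivAt.leibniz ξ L hD i (splits l) x).congr
      (extend_restrict_eventuallyEq _ x.2).symm

namespace SmoothFun

variable (U) in
/-- Multiplication of a smooth function on `V` by a test function on `V`, composed with a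
continuous linear map on the values and extended by zero to a smooth function on `U`. -/
noncomputable def mulExtend (ξ : TestFunction V ℝ ⊤) (L : E →L[ℝ] E') (f : SmoothFun V E) :
    SmoothFun U E' :=
  ⟨fun x => SmoothingKernels.mulExtend ξ L f x, _, f.isJet_deriv.leibniz ξ L⟩

theorem mulExtend_apply (ξ : TestFunction V ℝ ⊤) (L : E →L[ℝ] E') (f : SmoothFun V E) {x : U}
    (hx : (x : EuclideanSpace ℝ (Fin n)) ∈ V) : mulExtend U ξ L f x = ξ x • L (f ⟨x, hx⟩) :=
  mulExtend_of_mem ξ L f hx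

theorem mulExtend_apply_of_notMem (ξ : TestFunction V ℝ ⊤) (L : E →L[ℝ] E') (f : SmoothFun V E)
    {x : U} (hx : (x : EuclideanSpace ℝ (Fin n)) ∉ V) : mulExtend U ξ L f x = 0 := by
  change ξ x • L (Function.extend Subtype.val f 0 (x : EuclideanSpace ℝ (Fin n))) = 0
  rw [(testFunction_eventuallyEq_zero ξ hx).self_of_nhds, Pi.zero_apply, zero_smul]

theorem continuous_iff {X : Type*} [TopologicalSpace X] {F : X → SmoothFun V E} :
    Continuous F ↔ ∀ l, Continuous fun a => (F a).deriv l := by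
  simp only [continuous_iInf_rng, continuous_induced_rng]
  rfl

theorem tendsto_nhds_iff {ι : Type*} {p : Filter ι} {F : ι → SmoothFun V E}
    {f : SmoothFun V E} :
    Tendsto F p (𝓝 f) ↔ ∀ l, Tendsto (fun a => (F a).deriv l) p (𝓝 (f.deriv l)) := by
  simp only [nhds_iInf, nhds_induced, tendsto_iInf, tendsto_comap_iff]
  rfl

/-- As `V` is locally compact, `(f, x) ↦ f.deriv l x` is jointly continuous. So is the Leibniz sum,
and currying yields continuity into the compact-open topology. -/
theorem continuous_mulExtend [T2Space E'] (ξ : TestFunction V ℝ ⊤) (L : E →L[ℝ] E') :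
    Continuous (mulExtend U ξ L) := by
  have := V.isOpen.locallyCompactSpace
  refine continuous_iff.2 fun l => ContinuousMap.continuous_of_continuous_uncurry _ ?_
  have hD (l : List (Fin n)) :
      Continuous fun p : SmoothFun V E × V => p.1.deriv l p.2 :=
    ContinuousEval.continuous_eval.comp
      (((continuous_iff.1 continuous_id l).comp continuous_fst).prodMk continuous_snd)
  have h := (continuous_leibniz (D := fun (f : SmoothFun V E) l => ⇑(f.deriv l)) ξ L hD
    (splits l)).comp (continuous_id.prodMap (continuous_subtype_val (p := fun x => x ∈ U)))
  refine h.congr fun p => ?_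
  have := (mulExtend U ξ L p.1).deriv_eq (p.1.isJet_deriv.leibniz ξ L) l
  exact (congrFun this p.2).symm

end SmoothFun

end ZeroExtension

end SmoothingKernels

namespace SmoothingKernels

/-! ### Locality of smoothness and of convergence -/

section Gluing

variable {n : ℕ} {U V : Opens (EuclideanSpace ℝ (Fin n))}
  {E : Type*} [AddCommGroup E] [Module ℝ E] [TopologicalSpace E]

namespace SmoothFun

/-- Iterated partial derivatives are local. -/
theorem deriv_congr [T2Space E] {f : SmoothFun V E} {g : SmoothFun U E}
    {B : Set (EuclideanSpace ℝ (Fin n))} (hB : IsOpen B)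
    (h : ∀ y ∈ B, ∀ (hV : y ∈ V) (hU : y ∈ U), f ⟨y, hV⟩ = g ⟨y, hU⟩) (l : List (Fin n)) :
    ∀ y ∈ B, ∀ (hV : y ∈ V) (hU : y ∈ U), f.deriv l ⟨y, hV⟩ = g.deriv l ⟨y, hU⟩ := by
  induction l with
  | nil =>
    rw [f.isJet_deriv.nil, g.isJet_deriv.nil]
    exact h
  | cons i l ih =>
    intro y hy hV hU
    have hf := isPartialDeriv_iff.1 (f.isJet_deriv.cons l i) ⟨y, hV⟩
    have hg := isPartialDeriv_iff.1 (g.isJet_deriv.cons l i) ⟨y, hU⟩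
    refine (hf.congr ?_).unique hg
    filter_upwards [hB.mem_nhds hy, V.isOpen.mem_nhds hV, U.isOpen.mem_nhds hU] with z hz hzV hzU
    rw [extend_of_mem _ hzV, extend_of_mem _ hzU, ih z hz hzV hzU]

/-- A function that agrees locally with smooth functions is smooth. -/
theorem exists_isJet_of_locally [T2Space E] (hVU : V ≤ U) {f : V → E}
    (h : ∀ x : V, ∃ g : SmoothFun U E, ∃ B : Set (EuclideanSpace ℝ (Fin n)), IsOpen B ∧
      (x : EuclideanSpace ℝ (Fin n)) ∈ B ∧
        ∀ y : V, (y : EuclideanSpace ℝ (Fin n)) ∈ B → f y = g ⟨y, hVU y.2⟩) :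
    ∃ D, IsJet f D := by
  choose g B hB hxB hg using h
  -- The jet at `y` is read off from the local model chosen at `y`; near `x` it may be read off from
  -- the single model `g x` instead.
  have key (l : List (Fin n)) (x y : V) (hy : (y : EuclideanSpace ℝ (Fin n)) ∈ B x) :
      (g y).deriv l ⟨y, hVU y.2⟩ = (g x).deriv l ⟨y, hVU y.2⟩ := by
    refine deriv_congr (((hB x).inter (hB y)).inter V.isOpen) ?_ l y ⟨⟨hy, hxB y⟩, y.2⟩ _ _
    rintro z ⟨⟨hzx, hzy⟩, hzV⟩ hzU _
    rw [← hg y ⟨z, hzV⟩ hzy, ← hg x ⟨z, hzV⟩ hzx]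
  refine ⟨fun l x => (g x).deriv l ⟨x, hVU x.2⟩, ?_, fun l => ?_, fun l i => ?_⟩
  · funext x
    rw [(g x).isJet_deriv.nil, hg x x (hxB x)]
  · refine continuous_iff_continuousAt.2 fun x => ?_
    have hc : Continuous fun y : V => (g x).deriv l ⟨y, hVU y.2⟩ :=
      ((g x).deriv l).continuous.comp (continuous_subtype_val.subtype_mk _)
    refine hc.continuousAt.congr ?_
    filter_upwards [((hB x).preimage continuous_subtype_val).mem_nhds (hxB x)] with y hy
    exact (key l x y hy).symm
  · refine isPartialDeriv_iff.2 fun x => ?_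
    refine (isPartialDeriv_iff.1 ((g x).isJet_deriv.cons l i) ⟨x, hVU x.2⟩).congr ?_
    filter_upwards [(hB x).mem_nhds (hxB x), V.isOpen.mem_nhds x.2] with y hy hyV
    rw [extend_of_mem _ hyV, extend_of_mem _ (hVU hyV), key l x ⟨y, hyV⟩ hy]

/-- Convergence in `C^∞(V)` is a local property. -/
theorem tendsto_of_locally {ι : Type*} {p : Filter ι} (hVU : V ≤ U) {F : ι → CInf V} {f : CInf V}
    (h : ∀ x : V, ∃ (G : ι → CInf U) (g : CInf U) (B : Set (EuclideanSpace ℝ (Fin n))),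
      IsOpen B ∧ (x : EuclideanSpace ℝ (Fin n)) ∈ B ∧ Tendsto G p (𝓝 g) ∧
        ∀ y : V, (y : EuclideanSpace ℝ (Fin n)) ∈ B →
          (∀ a, F a y = G a ⟨y, hVU y.2⟩) ∧ f y = g ⟨y, hVU y.2⟩) :
    Tendsto F p (𝓝 f) := by
  have := U.isOpen.locallyCompactSpace
  refine tendsto_nhds_iff.2 fun l => ContinuousMap.tendsto_of_tendstoLocallyUniformly ?_
  intro u hu x
  obtain ⟨G, g, B, hB, hxB, hG, hFG⟩ := h x
  have hF (a : ι) := deriv_congr (f := F a) (g := G a) hB (fun y hy hV _ => (hFG ⟨y, hV⟩ hy).1 a) l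
  have hf := deriv_congr (f := f) (g := g) hB (fun y hy hV _ => (hFG ⟨y, hV⟩ hy).2) l
  -- On the locally compact `U`, compact convergence is locally uniform convergence, so it can be
  -- transferred from `G` to `F` near each point.
  obtain ⟨t, ht, hGt⟩ := ContinuousMap.tendsto_iff_tendstoLocallyUniformly.1
    (tendsto_nhds_iff.1 hG l) u hu ⟨x, hVU x.2⟩
  have hcont : Continuous fun y : V => (⟨y, hVU y.2⟩ : U) := continuous_subtype_val.subtype_mk _
  refine ⟨_, inter_mem (hcont.continuousAt ht)
    ((hB.preimage continuous_subtype_val).mem_nhds hxB), ?_⟩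
  filter_upwards [hGt] with a ha
  rintro y ⟨hyt, hyB⟩
  simpa only [← hF a y hyB y.2 (hVU y.2), ← hf y hyB y.2 (hVU y.2)] using ha _ hyt

theorem continuous_eval [T2Space E] (x : V) : Continuous fun f : SmoothFun V E => f x := by
  have h := continuous_iff.1 (continuous_id (X := SmoothFun V E)) []
  refine ((ContinuousEvalConst.continuous_eval_const x).comp h).congr fun f => ?_
  exact congrFun f.isJet_deriv.nil x

end SmoothFun

end Gluing

/-! ### Cutting off smoothing kernels -/

section Cutoff

variable {n : ℕ} {U V : Opens (EuclideanSpace ℝ (Fin n))}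

theorem exists_cutoff (x : V) : ∃ χ : TestFunction V ℝ ⊤,
    ∃ B : Set (EuclideanSpace ℝ (Fin n)), IsOpen B ∧ (x : EuclideanSpace ℝ (Fin n)) ∈ B ∧
      ∀ y ∈ B, χ y = 1 := by
  obtain ⟨r, hr, hrV⟩ := Metric.isOpen_iff.1 V.isOpen x x.2
  -- The support is the closed ball of radius `r / 2`, which lies in the open ball of radius `r`
  -- inside `V`.
  let b : ContDiffBump (x : EuclideanSpace ℝ (Fin n)) := ⟨r / 4, r / 2, by linarith, by linarith⟩
  refine ⟨⟨b, b.contDiff, b.hasCompactSupport, ?_⟩, Metric.ball x (r / 4), Metric.isOpen_ball,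
    Metric.mem_ball_self (by linarith), fun y hy =>
      b.one_of_mem_closedBall (Metric.ball_subset_closedBall hy)⟩
  rw [b.tsupport_eq]
  exact (Metric.closedBall_subset_ball (by change r / 2 < r; linarith)).trans hrV

/-- A smoothing kernel on `V`, cut off by a test function on `V`, as a smoothing kernel on `U`. -/
noncomputable def SK.cutoff (U : Opens (EuclideanSpace ℝ (Fin n))) (χ : TestFunction V ℝ ⊤)
    (φ : SK V) : SK U :=
  φ.mulExtend U χ (TestFunction.monoCLM ℝ : TestFunction V ℂ ⊤ →L[ℝ] TestFunction U ℂ ⊤)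

namespace SK

theorem cutoff_apply_coe (hVU : V ≤ U) (χ : TestFunction V ℝ ⊤) (φ : SK V) {x : U}
    (hx : (x : EuclideanSpace ℝ (Fin n)) ∈ V) :
    (⇑(cutoff U χ φ x) : EuclideanSpace ℝ (Fin n) → ℂ) = χ x • ⇑(φ ⟨x, hx⟩) := by
  rw [cutoff, SmoothFun.mulExtend_apply _ _ _ hx, FunLike.coe_smul, TestFunction.monoCLM_apply,
    if_pos ⟨le_rfl, hVU⟩]

theorem cutoff_apply_coe_of_one (hVU : V ≤ U) {χ : TestFunction V ℝ ⊤} (φ : SK V) {x : V}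
    (hx : χ x = 1) :
    (⇑(cutoff U χ φ ⟨x, hVU x.2⟩) : EuclideanSpace ℝ (Fin n) → ℂ) = ⇑(φ x) := by
  rw [cutoff_apply_coe hVU χ φ (x := ⟨x, hVU x.2⟩) x.2, hx, one_smul]

theorem cutoff_apply_of_notMem (χ : TestFunction V ℝ ⊤) (φ : SK V) {x : U}
    (hx : (x : EuclideanSpace ℝ (Fin n)) ∉ V) : cutoff U χ φ x = 0 :=
  SmoothFun.mulExtend_apply_of_notMem _ _ _ hx

theorem continuous_cutoff (χ : TestFunction V ℝ ⊤) : Continuous (cutoff U χ) :=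
  SmoothFun.continuous_mulExtend _ _

theorem cutoff_add (hVU : V ≤ U) (χ : TestFunction V ℝ ⊤) (φ ψ : SK V) :
    cutoff U χ (φ + ψ) = cutoff U χ φ + cutoff U χ ψ := by
  refine SmoothFun.ext fun x => ?_
  change _ = cutoff U χ φ x + cutoff U χ ψ x
  by_cases hx : (x : EuclideanSpace ℝ (Fin n)) ∈ V
  · refine DFunLike.coe_injective ?_
    rw [FunLike.coe_add]
    simp only [cutoff_apply_coe hVU _ _ hx]
    change χ x • ⇑(φ ⟨x, hx⟩ + ψ ⟨x, hx⟩) = _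
    rw [FunLike.coe_add, smul_add]
  · simp only [cutoff_apply_of_notMem _ _ hx, add_zero]

/-- The scalar field is generic because real scalars occur in difference quotients of curves and
complex ones in the linearity of `R`. -/
theorem cutoff_smul {𝕜 : Type*} [NormedField 𝕜] [NormedSpace 𝕜 ℂ] [SMulCommClass ℝ 𝕜 ℂ]
    [ContinuousConstSMul 𝕜 (TestFunction U ℂ ⊤)] [ContinuousConstSMul 𝕜 (TestFunction V ℂ ⊤)]
    [SMulCommClass ℝ 𝕜 (TestFunction U ℂ ⊤)] [SMulCommClass ℝ 𝕜 (TestFunction V ℂ ⊤)]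
    (hVU : V ≤ U) (χ : TestFunction V ℝ ⊤) (a : 𝕜) (φ : SK V) :
    cutoff U χ (a • φ) = a • cutoff U χ φ := by
  refine SmoothFun.ext fun x => ?_
  change _ = a • cutoff U χ φ x
  by_cases hx : (x : EuclideanSpace ℝ (Fin n)) ∈ V
  · refine DFunLike.coe_injective ?_
    rw [FunLike.coe_smul]
    simp only [cutoff_apply_coe hVU _ _ hx]
    change χ x • ⇑(a • φ ⟨x, hx⟩) = _
    rw [FunLike.coe_smul, smul_comm]
  · simp only [cutoff_apply_of_notMem _ _ hx, smul_zero]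

/-- A continuous linear map commutes with limits of difference quotients. -/
theorem isSmoothMap_cutoff (hVU : V ≤ U) (χ : TestFunction V ℝ ⊤) :
    IsSmoothMap (cutoff U χ) := by
  rintro c ⟨D, rfl, hD⟩
  refine ⟨fun k => cutoff U χ ∘ D k, rfl, fun k t => ?_⟩
  refine (((continuous_cutoff χ).tendsto _).comp (hD k t)).congr fun h => ?_
  have hsub (φ ψ : SK V) : cutoff U χ (φ - ψ) = cutoff U χ φ - cutoff U χ ψ := by
    rw [eq_sub_iff_add_eq, ← cutoff_add hVU, sub_add_cancel]
  simp only [Function.comp_apply, cutoff_smul hVU, hsub]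

end SK

end Cutoff

end SmoothingKernels

namespace SmoothingKernels

/-! ### Construction and properties of the restriction -/

section Restriction

variable {n : ℕ} {U V : Opens (EuclideanSpace ℝ (Fin n))}

/-- A test function on `V` that is equal to `1` near `x`. -/
noncomputable def bump (x : V) : TestFunction V ℝ ⊤ := (exists_cutoff x).choose

/-- A neighbourhood of `x` on which `bump x` is equal to `1`. -/
def bumpNhd (x : V) : Set (EuclideanSpace ℝ (Fin n)) := (exists_cutoff x).choose_spec.choose

theorem isOpen_bumpNhd (x : V) : IsOpen (bumpNhd x) :=
  (exists_cutoff x).choose_spec.choose_spec.1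

theorem mem_bumpNhd (x : V) : (x : EuclideanSpace ℝ (Fin n)) ∈ bumpNhd x :=
  (exists_cutoff x).choose_spec.choose_spec.2.1

theorem bump_eq_one (x : V) {y : EuclideanSpace ℝ (Fin n)} (hy : y ∈ bumpNhd x) :
    bump x y = 1 :=
  (exists_cutoff x).choose_spec.choose_spec.2.2 y hy

namespace BasicSpace

theorem IsLocal.eqOn_of_coe_eq {R : BasicSpace U} (hR : R.IsLocal) (hVU : V ≤ U)
    {B : Set (EuclideanSpace ℝ (Fin n))} (hB : IsOpen B) {φ ψ : SK U}
    (h : ∀ y : V, (y : EuclideanSpace ℝ (Fin n)) ∈ B →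
      (⇑(φ ⟨y, hVU y.2⟩) : EuclideanSpace ℝ (Fin n) → ℂ) = ⇑(ψ ⟨y, hVU y.2⟩))
    (x : V) (hx : (x : EuclideanSpace ℝ (Fin n)) ∈ B) :
    R φ ⟨x, hVU x.2⟩ = R ψ ⟨x, hVU x.2⟩ :=
  hR (⟨B, hB⟩ ⊓ V) (inf_le_right.trans hVU) φ ψ
    (fun y hy => DFunLike.coe_injective (h ⟨y, hy.2⟩ hy.1)) ⟨x, hVU x.2⟩ ⟨hx, x.2⟩

/-- The values of the restriction of `R` to `V`: localize the kernel near each point. -/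
noncomputable def restrictFun (hVU : V ≤ U) (R : BasicSpace U) (φ : SK V) (x : V) : ℂ :=
  R (SK.cutoff U (bump x) φ) ⟨x, hVU x.2⟩

/-- This gives independence of the chosen cutoff: on `B ∩ bumpNhd x` the kernel `ψ` and the cutoff
of `φ` both coincide with `φ`, so locality of `R` applies. -/
theorem restrictFun_eq {R : BasicSpace U} (hR : R.IsLocal) (hVU : V ≤ U)
    {B : Set (EuclideanSpace ℝ (Fin n))} (hB : IsOpen B) {φ : SK V} {ψ : SK U}
    (h : ∀ y : V, (y : EuclideanSpace ℝ (Fin n)) ∈ B →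
      (⇑(φ y) : EuclideanSpace ℝ (Fin n) → ℂ) = ⇑(ψ ⟨y, hVU y.2⟩))
    (x : V) (hx : (x : EuclideanSpace ℝ (Fin n)) ∈ B) :
    restrictFun hVU R φ x = R ψ ⟨x, hVU x.2⟩ := by
  refine hR.eqOn_of_coe_eq hVU (hB.inter (isOpen_bumpNhd x)) ?_ x ⟨hx, mem_bumpNhd x⟩
  rintro y ⟨hyB, hyx⟩
  rw [SK.cutoff_apply_coe_of_one hVU φ (bump_eq_one x hyx), h y hyB]

theorem restrictFun_eq_bump {R : BasicSpace U} (hR : R.IsLocal) (hVU : V ≤ U) (φ : SK V) (x y : V)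
    (hy : (y : EuclideanSpace ℝ (Fin n)) ∈ bumpNhd x) :
    restrictFun hVU R φ y = R (SK.cutoff U (bump x) φ) ⟨y, hVU y.2⟩ :=
  restrictFun_eq hR hVU (isOpen_bumpNhd x)
    (fun _ hz => (SK.cutoff_apply_coe_of_one hVU φ (bump_eq_one x hz)).symm) y hy

/-- The values of the restriction of `R` to `V` as a smooth function. -/
noncomputable def restrictSmoothFun {R : BasicSpace U} (hR : R.IsLocal) (hVU : V ≤ U) (φ : SK V) :
    CInf V :=
  ⟨restrictFun hVU R φ, SmoothFun.exists_isJet_of_locally hVU fun x =>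
    ⟨R (SK.cutoff U (bump x) φ), bumpNhd x, isOpen_bumpNhd x, mem_bumpNhd x,
      restrictFun_eq_bump hR hVU φ x⟩⟩

/-- For each `x` the curve `R` of the cutoff of `c t` by `bump x` is smooth. Its derivatives for
different `x` agree on overlaps and glue to the derivatives of the restricted curve. -/
theorem isSmoothMap_restrictSmoothFun {R : BasicSpace U} (hR : R.IsLocal) (hVU : V ≤ U) :
    IsSmoothMap (restrictSmoothFun hR hVU) := by
  intro c hc
  choose D hD0 hD using fun x : V => R.smooth' _ (SK.isSmoothMap_cutoff hVU (bump x) c hc)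
  have key (x y : V) (k : ℕ) : ∀ (t : ℝ) (z : V), (z : EuclideanSpace ℝ (Fin n)) ∈ bumpNhd x →
      (z : EuclideanSpace ℝ (Fin n)) ∈ bumpNhd y →
        D x k t ⟨z, hVU z.2⟩ = D y k t ⟨z, hVU z.2⟩ := by
    induction k with
    | zero =>
      intro t z hx hy
      rw [hD0, hD0]
      exact (restrictFun_eq_bump hR hVU (c t) x z hx).symm.trans
        (restrictFun_eq_bump hR hVU (c t) y z hy)
    | succ k ih =>
      intro t z hx hy
      -- Evaluation at `z` turns both derivatives into limits of the same scalar difference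
      -- quotients.
      have h (w : V) := ((SmoothFun.continuous_eval ⟨(z : EuclideanSpace ℝ (Fin n)),
        hVU z.2⟩).tendsto _).comp (hD w k t)
      refine tendsto_nhds_unique (h x) ((h y).congr fun s => ?_)
      change s⁻¹ • (D y k (t + s) _ - D y k t _) = s⁻¹ • (D x k (t + s) _ - D x k t _)
      rw [ih _ z hx hy, ih _ z hx hy]
  refine ⟨fun k t => ⟨fun x => D x k t ⟨x, hVU x.2⟩, SmoothFun.exists_isJet_of_locally hVU
    fun x => ⟨D x k t, bumpNhd x, isOpen_bumpNhd x, mem_bumpNhd x, fun y hy =>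
      key y x k t y (mem_bumpNhd y) hy⟩⟩, ?_, fun k t => ?_⟩
  · funext t
    refine SmoothFun.ext fun x => ?_
    change D x 0 t _ = _
    rw [hD0]
    rfl
  · refine SmoothFun.tendsto_of_locally hVU fun x => ⟨_, _, bumpNhd x, isOpen_bumpNhd x,
      mem_bumpNhd x, hD x k t, fun y hy => ⟨fun s => ?_, key y x _ t y (mem_bumpNhd y) hy⟩⟩
    change s⁻¹ • (D y k (t + s) _ - D y k t _) = s⁻¹ • (D x k (t + s) _ - D x k t _)
    rw [key y x k _ y (mem_bumpNhd y) hy, key y x k _ y (mem_bumpNhd y) hy]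

/-- The restriction of a local element of the basic space on `U` to `V ⊆ U`. -/
noncomputable def restrict {R : BasicSpace U} (hR : R.IsLocal) (hVU : V ≤ U) : BasicSpace V :=
  ⟨restrictSmoothFun hR hVU, isSmoothMap_restrictSmoothFun hR hVU⟩

theorem restrict_eq {R : BasicSpace U} (hR : R.IsLocal) (hVU : V ≤ U)
    {B : Set (EuclideanSpace ℝ (Fin n))} (hB : IsOpen B) {φ : SK V} {ψ : SK U}
    (h : ∀ y : V, (y : EuclideanSpace ℝ (Fin n)) ∈ B →
      (⇑(φ y) : EuclideanSpace ℝ (Fin n) → ℂ) = ⇑(ψ ⟨y, hVU y.2⟩))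
    (x : V) (hx : (x : EuclideanSpace ℝ (Fin n)) ∈ B) :
    restrict hR hVU φ x = R ψ ⟨x, hVU x.2⟩ :=
  restrictFun_eq hR hVU hB h x hx

theorem restrict_eq_bump {R : BasicSpace U} (hR : R.IsLocal) (hVU : V ≤ U) (φ : SK V) (x y : V)
    (hy : (y : EuclideanSpace ℝ (Fin n)) ∈ bumpNhd x) :
    restrict hR hVU φ y = R (SK.cutoff U (bump x) φ) ⟨y, hVU y.2⟩ :=
  restrictFun_eq_bump hR hVU φ x y hy

theorem coe_cutoff_bump_self (hVU : V ≤ U) (φ : SK V) (x : V) :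
    (⇑(SK.cutoff U (bump x) φ ⟨x, hVU x.2⟩) : EuclideanSpace ℝ (Fin n) → ℂ) = ⇑(φ x) :=
  SK.cutoff_apply_coe_of_one hVU φ (bump_eq_one x (mem_bumpNhd x))

theorem isLocal_restrict {R : BasicSpace U} (hR : R.IsLocal) (hVU : V ≤ U) :
    (restrict hR hVU).IsLocal := by
  intro W _ φ ψ h x hx
  rw [restrict_eq_bump hR hVU ψ x x (mem_bumpNhd x)]
  refine restrict_eq hR hVU (W.isOpen.inter (isOpen_bumpNhd x)) ?_ x ⟨hx, mem_bumpNhd x⟩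
  rintro y ⟨hyW, hyx⟩
  rw [SK.cutoff_apply_coe_of_one hVU ψ (bump_eq_one x hyx), h y hyW]

theorem isRestriction_restrict (Ω : Opens (EuclideanSpace ℝ (Fin n))) {R : BasicSpace U}
    (hR : R.IsLocal) (hVU : V ≤ U) : IsRestriction Ω hVU R (restrict hR hVU) :=
  fun W _ _ _ _ h x hx => restrict_eq hR hVU W.isOpen h x hx

theorem eq_restrict_of_isRestriction {Ω : Opens (EuclideanSpace ℝ (Fin n))} (hU : U ≤ Ω)
    {R : BasicSpace U} (hR : R.IsLocal) (hVU : V ≤ U) {S : BasicSpace V}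
    (hS : IsRestriction Ω hVU R S) : S = restrict hR hVU := by
  refine DFunLike.ext _ _ fun φ => SmoothFun.ext fun x => ?_
  -- Taking the closed ball inside `V` makes the open ball an admissible `W` in the defining
  -- property; on it the cutoff of `φ` is a kernel on `U` that agrees with `φ`.
  obtain ⟨r, hr, hrV⟩ := Metric.nhds_basis_closedBall.mem_iff.1
    (((isOpen_bumpNhd x).inter V.isOpen).mem_nhds ⟨mem_bumpNhd x, x.2⟩)
  have hball : Metric.ball (x : EuclideanSpace ℝ (Fin n)) r ⊆ bumpNhd x ∩ V :=
    Metric.ball_subset_closedBall.trans hrV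
  rw [restrict_eq_bump hR hVU φ x x (mem_bumpNhd x)]
  refine hS ⟨Metric.ball x r, Metric.isOpen_ball⟩ (fun y hy => hU (hVU (hball hy).2)) ?_ φ _ ?_ x
    (Metric.mem_ball_self hr)
  · exact fun y hy => (hrV (Metric.closure_ball_subset_closedBall hy.1)).2
  · exact fun y hy => (SK.cutoff_apply_coe_of_one hVU φ (bump_eq_one x (hball hy).1)).symm

theorem IsLinear.restrict {R : BasicSpace U} (hR : R.IsLocal) (hVU : V ≤ U) (h : R.IsLinear) :
    (restrict hR hVU).IsLinear where
  map_add φ ψ := by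
    refine SmoothFun.ext fun x => ?_
    change R (SK.cutoff U (bump x) (φ + ψ)) _ =
      R (SK.cutoff U (bump x) φ) _ + R (SK.cutoff U (bump x) ψ) _
    rw [SK.cutoff_add hVU, h.map_add]
    rfl
  map_smul a φ := by
    refine SmoothFun.ext fun x => ?_
    change R (SK.cutoff U (bump x) (a • φ)) _ = a • R (SK.cutoff U (bump x) φ) _
    rw [SK.cutoff_smul hVU, h.map_smul]
    rfl

theorem IsContinuousLinear.restrict {R : BasicSpace U} (hR : R.IsLocal) (hVU : V ≤ U)
    (h : R.IsContinuousLinear) : (restrict hR hVU).IsContinuousLinear := by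
  refine ⟨h.1.restrict hR hVU, continuous_iff_continuousAt.2 fun φ => ?_⟩
  -- Near `x` the restriction is the continuous map `R` composed with the continuous cutoff by `bump
  -- x`.
  exact SmoothFun.tendsto_of_locally hVU fun x =>
    ⟨_, _, bumpNhd x, isOpen_bumpNhd x, mem_bumpNhd x,
      (h.2.comp (SK.continuous_cutoff (bump x))).tendsto φ, fun y hy =>
        ⟨fun ψ => restrict_eq_bump hR hVU ψ x y hy, restrict_eq_bump hR hVU φ x y hy⟩⟩

theorem IsPointIndependent.restrict {R : BasicSpace U} (hR : R.IsLocal) (hVU : V ≤ U)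
    (h : R.IsPointIndependent) : (restrict hR hVU).IsPointIndependent := by
  intro x y φ ψ hxy
  -- At its own centre a cutoff leaves the value of the kernel unchanged, so the hypothesis on `φ`
  -- and `ψ` passes to their cutoffs.
  refine h _ _ _ _ (DFunLike.coe_injective ?_)
  exact (coe_cutoff_bump_self hVU φ x).trans
    ((congrArg DFunLike.coe hxy).trans (coe_cutoff_bump_self hVU ψ y).symm)

theorem IsPointLocal.restrict {R : BasicSpace U} (hR : R.IsLocal) (hVU : V ≤ U)
    (h : R.IsPointLocal) : (restrict hR hVU).IsPointLocal := by
  intro x φ ψ hxy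
  refine h _ _ _ (DFunLike.coe_injective ?_)
  exact (coe_cutoff_bump_self hVU φ x).trans
    ((congrArg DFunLike.coe hxy).trans (coe_cutoff_bump_self hVU ψ x).symm)

theorem restrict_restrict {W : Opens (EuclideanSpace ℝ (Fin n))} {R : BasicSpace U}
    (hR : R.IsLocal) (hVU : V ≤ U) (hWV : W ≤ V) :
    restrict (isLocal_restrict hR hVU) hWV = restrict hR (hWV.trans hVU) := by
  refine DFunLike.ext _ _ fun φ => SmoothFun.ext fun x => ?_
  rw [restrict_eq_bump _ hWV φ x x (mem_bumpNhd x),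
    restrict_eq_bump hR (hWV.trans hVU) φ x x (mem_bumpNhd x)]
  -- The cutoffs of `φ` to `V` and to `U` both agree with `φ` near `x`, hence with each other.
  refine restrict_eq hR hVU ((isOpen_bumpNhd x).inter W.isOpen) ?_ ⟨x, hWV x.2⟩
    ⟨mem_bumpNhd x, x.2⟩
  rintro y ⟨hyx, hyW⟩
  have hy := bump_eq_one x hyx
  exact (SK.cutoff_apply_coe_of_one hWV φ (x := ⟨y, hyW⟩) hy).trans
    (SK.cutoff_apply_coe_of_one (hWV.trans hVU) φ (x := ⟨y, hyW⟩) hy).symm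

end BasicSpace

end Restriction

end SmoothingKernels
theorem mainTheorem6 {n : ℕ} (Ω : Opens (EuclideanSpace ℝ (Fin n))) :
    ∃ res : ∀ {U V : Opens (EuclideanSpace ℝ (Fin n))}, U ≤ Ω → V ≤ U → ELoc U → ELoc V,
      (∀ {U V : Opens (EuclideanSpace ℝ (Fin n))} (hU : U ≤ Ω) (hVU : V ≤ U) (R : ELoc U),
        -- `R|_V` has the defining property, and it is the only such element of `𝓔_loc(V)`
        IsRestriction Ω hVU R.1 (res hU hVU R).1 ∧
        (∀ S : ELoc V, IsRestriction Ω hVU R.1 S.1 → S = res hU hVU R) ∧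
        -- linearity, continuous linearity, point-locality, point-independence are preserved
        (R.1.IsLinear → (res hU hVU R).1.IsLinear) ∧
        (R.1.IsContinuousLinear → (res hU hVU R).1.IsContinuousLinear) ∧
        (R.1.IsPointLocal → (res hU hVU R).1.IsPointLocal) ∧
        (R.1.IsPointIndependent → (res hU hVU R).1.IsPointIndependent)) ∧
      (∀ {U V W : Opens (EuclideanSpace ℝ (Fin n))} (hU : U ≤ Ω) (hVU : V ≤ U) (hWV : W ≤ V)
        (R : ELoc U),
        res (hVU.trans hU) hWV (res hU hVU R) = res hU (hWV.trans hVU) R) :=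
  ⟨fun _ hVU R => ⟨BasicSpace.restrict R.2 hVU, BasicSpace.isLocal_restrict R.2 hVU⟩,
    fun hU hVU R => ⟨BasicSpace.isRestriction_restrict Ω R.2 hVU,
      fun _ hS => Subtype.ext (BasicSpace.eq_restrict_of_isRestriction hU R.2 hVU hS),
      fun h => h.restrict R.2 hVU, fun h => h.restrict R.2 hVU,
      fun h => h.restrict R.2 hVU, fun h => h.restrict R.2 hVU⟩,
    fun _ hVU hWV R => Subtype.ext (BasicSpace.restrict_restrict R.2 hVU hWV)⟩
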